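/- Let $N>1$ be an odd integer and let $x>0$ be a real number. Then $$\sum_{n=1}^{\infty}\frac{1}{n\left(e^{n^N x}-1\right)}=\frac{1}{2N}\left(\gamma(1-N)+\log\frac{x}{2\pi}\right)+\frac{\zeta(N+1)}{x}+\frac{(-1)^{\frac{N+3}{2}}}{N}\sum_{j}\ \sum_{n=1}^{\infty}\frac1n\cdot\frac{e^{i\pi j/2}}{\exp\left(2\pi\left(\frac{2\pi n}{x}\right)^{1/N}e^{-\frac{i\pi j}{2N}}\right)-1},$$ where $j$ runs over the $N$ integers $-(N-1),-(N-3),\ldots,N-3,N-1$, $\gamma$ is Euler's constant, $\zeta$ is the Riemann zeta function, $(2\pi n/x)^{1/N}$ is the positive real root, and all the infinite series converge absolutely. -/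

import Mathlib

/-- The term with index `n ≥ 1` of the rotated Lambert series,
`(1 / n) * exp(iπj/2) / (exp(2π (2πn/x)^(1/N) exp(-iπj/(2N))) - 1)`. The root
`(2πn/x)^(1/N)` is the positive real `N`-th root, for `x > 0`. -/
noncomputable def rotatedLambertTerm (N : ℕ) (x : ℝ) (j : ℤ) (n : ℕ+) : ℂ :=
  1 / ((n : ℕ) : ℂ) *
    (Complex.exp (Complex.I * Real.pi * (j : ℂ) / 2) /
      (Complex.exp
          (2 * Real.pi * (((2 * Real.pi * ((n : ℕ) : ℝ) / x) ^ ((1 : ℝ) / (N : ℝ)) : ℝ) : ℂ) *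
            Complex.exp (-(Complex.I * Real.pi * (j : ℂ)) / (2 * (N : ℂ)))) - 1))

/-- The range of the doubly primed sum: the integers
`-(N-1), -(N-3), …, N-3, N-1`, in steps of two. -/
def stepTwoIndices (N : ℕ) : Finset ℤ :=
  (Finset.range N).image fun k : ℕ => 2 * (k : ℤ) - ((N : ℤ) - 1)

/-! Write `d = N - 1`, `c = 2π/x` and sum `K_m(t) = c t^d / (t^(2N) + (c m)^2)` over integers `t = n
≥ 1` and `m ≥ 1` in both orders. Over `m`, the coth expansion gives `π / (n (exp(n^N x) - 1)) + π /
(2n) - π / (x n^(N+1))`: the Lambert term, a harmonic term and a zeta term. Over `n`, partial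
fractions in `n^2` followed by the same expansion give `π / (2 N m)` plus the rotated Lambert terms
(`hasSum_pow_div_pow_add_pow`).

The harmonic parts make the double series diverge. Subtracting from `K_m(n + 1)` the integral of
`K_m` over `[n, n + 1]` makes it absolutely summable (`summable_lambertDefect`), so the orders may
be exchanged (`lambertKernel_interchange`). In one order the integrals remove exactly `π / (2 N m)`;
in the other they leave `∑ arctan(y / m) / m` at `y = A^N / c`, which is `(π/2)(log y + γ) + o(1)`.
Comparing this with the harmonic sum produces the logarithm and Euler's constant. -/

/-! ### Partial fractions over roots of unity and the coth expansion. -/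

/-- Partial fractions of `w ^ q / (w ^ N - v ^ N)` over the `N`-th roots of `v ^ N`. -/
theorem IsPrimitiveRoot.sum_pow_succ_div_sub {N q : ℕ} {ω : ℂ} (hω : IsPrimitiveRoot ω N)
    (hq : q < N) (v w : ℂ) (hne : ∀ k ∈ Finset.range N, w - v * ω ^ k ≠ 0) :
    (w ^ N - v ^ N) * ∑ k ∈ Finset.range N, (v * ω ^ k) ^ (q + 1) / (w - v * ω ^ k) =
      N * v ^ N * w ^ q := by
  have hroot : ∀ k, (v * ω ^ k) ^ N = v ^ N := fun k => by
    rw [mul_pow, ← pow_mul, mul_comm k N, pow_mul, hω.pow_eq_one, one_pow, mul_one]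
  have hterm : ∀ k ∈ Finset.range N,
      (w ^ N - v ^ N) * ((v * ω ^ k) ^ (q + 1) / (w - v * ω ^ k)) =
        ∑ l ∈ Finset.range N, w ^ l * (v * ω ^ k) ^ (N - 1 - l + (q + 1)) := by
    intro k hk
    rw [← hroot k, ← geom_sum₂_mul]
    field_simp [hne k hk]
    rw [Finset.sum_mul]
    exact Finset.sum_congr rfl fun l _ => by rw [pow_add]; ring
  -- Power sums of the roots vanish unless `N` divides the exponent `N - 1 - l + (q + 1)`. It lies
  -- strictly between `0` and `2 N`, so only `l = q` survives.
  rw [Finset.mul_sum, Finset.sum_congr rfl hterm, Finset.sum_comm,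
    Finset.sum_eq_single_of_mem q (Finset.mem_range.2 hq)]
  · have : N - 1 - q + (q + 1) = N := by omega
    simp only [this, hroot]
    simp
    ring
  · intro l hl hlq
    rw [Finset.mem_range] at hl
    rw [← Finset.mul_sum]
    set r := N - 1 - l + (q + 1) with hr
    have hr1 : ω ^ r ≠ 1 := by
      rw [Ne, hω.pow_eq_one_iff_dvd]
      rintro ⟨s, hs⟩
      rcases s with _ | _ | s
      · omega
      · omega
      · have : N * (s + 1 + 1) = N * s + N + N := by ring
        omega
    have hsum : ∑ k ∈ Finset.range N, (ω ^ r) ^ k = 0 := by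
      have h := geom_sum_mul (ω ^ r) N
      rw [← pow_mul, mul_comm r N, pow_mul, hω.pow_eq_one, one_pow, sub_self] at h
      exact (mul_eq_zero.1 h).resolve_right (sub_ne_zero.2 hr1)
    have : ∀ k ∈ Finset.range N, (v * ω ^ k) ^ r = v ^ r * (ω ^ r) ^ k := fun k _ => by
      rw [mul_pow, ← pow_mul, ← pow_mul, mul_comm k r]
    rw [Finset.sum_congr rfl this, ← Finset.mul_sum, hsum]
    simp

theorem Complex.exp_sub_one_ne_zero_of_re_pos {z : ℂ} (hz : 0 < z.re) : Complex.exp z - 1 ≠ 0 := by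
  intro h
  have h1 : ‖Complex.exp z‖ = 1 := by rw [sub_eq_zero.1 h]; simp
  rw [Complex.norm_exp] at h1
  exact (Real.one_lt_exp_iff.2 hz).ne' h1

/-- The Mittag-Leffler expansion of the hyperbolic cotangent. -/
theorem Complex.hasSum_inv_sq_add_sq {b : ℂ} (hb : 0 < b.re) :
    HasSum (fun n : ℕ => 1 / (((n : ℂ) + 1) ^ 2 + b ^ 2))
      (Real.pi / (2 * b) + Real.pi / b / (Complex.exp (2 * Real.pi * b) - 1) -
        1 / (2 * b ^ 2)) := by
  have hb0 : b ≠ 0 := by rintro rfl; simp at hb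
  have him : (I * b).im = b.re := by simp
  -- The cotangent series is used at `I * b`, off the real axis because `b.re > 0`.
  have hz : I * b ∈ Complex.integerComplement := by
    rintro ⟨n, hn⟩
    rw [← hn] at him
    simp at him
    linarith
  have hE : Complex.exp (2 * Real.pi * b) - 1 ≠ 0 := by
    apply Complex.exp_sub_one_ne_zero_of_re_pos
    have : (2 * (Real.pi : ℂ) * b).re = 2 * Real.pi * b.re := by
      simp [Complex.mul_re]
    rw [this]; positivity
  have hs := (summable_cotTerm hz).hasSum
  have hs2 := cot_series_rep' hz
  simp only [cotTerm] at hs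
  rw [← hs2, Complex.cot_pi_eq_exp_ratio] at hs
  have he : Complex.exp (2 * Real.pi * I * (I * b)) = (Complex.exp (2 * Real.pi * b))⁻¹ := by
    rw [← Complex.exp_neg]; congr 1
    linear_combination 2 * Real.pi * b * Complex.I_mul_I
  rw [he] at hs
  have hne : ∀ n : ℕ, ((n : ℂ) + 1) ^ 2 + b ^ 2 ≠ 0 ∧ I * b - (n + 1) ≠ 0 ∧ I * b + (n + 1) ≠ 0 := by
    intro n
    have h1 : I * b - (n + 1) ≠ 0 := by
      intro h; apply hz; exact ⟨n + 1, by rw [sub_eq_zero] at h; rw [h]; push_cast; ring⟩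
    have h2 : I * b + (n + 1) ≠ 0 := by
      intro h; apply hz
      exact ⟨-(n + 1), by rw [add_eq_zero_iff_eq_neg] at h; rw [h]; push_cast; ring⟩
    refine ⟨?_, h1, h2⟩
    have := mul_ne_zero h1 h2
    intro h
    apply this
    linear_combination b ^ 2 * Complex.I_mul_I - h
  have hI := Complex.I_ne_zero
  have hfun : (fun n : ℕ => 1 / (((n : ℂ) + 1) ^ 2 + b ^ 2)) = fun n : ℕ =>
      -(1 / (2 * I * b)) * (1 / (I * b - (n + 1)) + 1 / (I * b + (n + 1))) := by
    ext n
    obtain ⟨h1, h2, h3⟩ := hne n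
    have hprod : ((n : ℂ) + 1) ^ 2 + b ^ 2 = -((I * b - (n + 1)) * (I * b + (n + 1))) := by
      linear_combination b ^ 2 * Complex.I_mul_I
    rw [hprod]
    field_simp
    ring
  rw [hfun]
  have hE0 := Complex.exp_ne_zero (2 * Real.pi * b)
  set E := Complex.exp (2 * Real.pi * b)
  have h1E : 1 - E⁻¹ ≠ 0 := by
    intro h; apply hE
    have : E * (1 - E⁻¹) = E - 1 := by field_simp
    rw [← this, h, mul_zero]
  have e1 : (E⁻¹ + 1) / (I * (1 - E⁻¹)) = (E + 1) / (I * (E - 1)) := by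
    rw [div_eq_div_iff (mul_ne_zero hI h1E) (mul_ne_zero hI hE)]
    field_simp
    ring
  rw [e1] at hs
  refine Eq.subst (motive := fun y => HasSum _ y) ?_ (hs.mul_left (-(1 / (2 * I * b))))
  symm
  have hI2 := Complex.I_sq
  field_simp
  rw [hI2]
  ring

/-! ### The rotated points and the sum over `n`. -/

theorem sum_stepTwoIndices {M : Type*} [AddCommMonoid M] (N : ℕ) (f : ℤ → M) :
    ∑ j ∈ stepTwoIndices N, f j = ∑ k ∈ Finset.range N, f (2 * (k : ℤ) - ((N : ℤ) - 1)) := by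
  rw [stepTwoIndices, Finset.sum_image]
  intro a _ b _ h
  simp only at h
  omega

theorem abs_lt_of_mem_stepTwoIndices {N : ℕ} {j : ℤ} (hj : j ∈ stepTwoIndices N) :
    -(N : ℤ) < j ∧ j < N := by
  simp only [stepTwoIndices, Finset.mem_image, Finset.mem_range] at hj
  obtain ⟨k, hk, rfl⟩ := hj
  omega

/-- Since `|j| < N`, the angle `π j / (2 N)` lies in `(-π/2, π/2)`. This keeps every rotated point
in the half-plane of the coth expansion. -/
theorem rotation_re_pos {N : ℕ} {j : ℤ} (hj : j ∈ stepTwoIndices N) :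
    0 < (Complex.exp (-(Complex.I * Real.pi * (j : ℂ)) / (2 * (N : ℂ)))).re := by
  obtain ⟨h1, h2⟩ := abs_lt_of_mem_stepTwoIndices hj
  have hN : (0 : ℝ) < N := by
    have : (0 : ℤ) < N := by omega
    exact_mod_cast this
  have h1' : -(N : ℝ) < j := by exact_mod_cast h1
  have h2' : (j : ℝ) < N := by exact_mod_cast h2
  have he : -(Complex.I * Real.pi * (j : ℂ)) / (2 * (N : ℂ)) =
      ((-(Real.pi * j / (2 * N)) : ℝ) : ℂ) * Complex.I := by
    push_cast; ring
  rw [he, Complex.exp_ofReal_mul_I_re, Real.cos_neg]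
  have hpi := Real.pi_pos
  apply Real.cos_pos_of_mem_Ioo
  constructor
  · rw [lt_div_iff₀ (by positivity)]
    nlinarith
  · rw [div_lt_iff₀ (by positivity)]
    nlinarith

/-- Summation of `t ^ (N - 1) / (t ^ (2 * N) + a ^ (2 * N))` over the positive integers, for odd
`N = 2 * e + 1`. -/
theorem hasSum_pow_div_pow_add_pow {e : ℕ} (he : 1 ≤ e) {a : ℝ} (ha : 0 < a) :
    HasSum (fun n : ℕ => ((n : ℂ) + 1) ^ (2 * e) /
        (((n : ℂ) + 1) ^ (2 * (2 * e + 1)) + (a : ℂ) ^ (2 * (2 * e + 1))))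
      (Real.pi / (a : ℂ) ^ (2 * e + 1) * (1 / (2 * ((2 * e + 1 : ℕ) : ℂ)) +
        (-1) ^ e / ((2 * e + 1 : ℕ) : ℂ) * ∑ j ∈ stepTwoIndices (2 * e + 1),
          Complex.exp (Complex.I * Real.pi * (j : ℂ) / 2) /
            (Complex.exp (2 * Real.pi * a *
              Complex.exp (-(Complex.I * Real.pi * (j : ℂ)) / (2 * ((2 * e + 1 : ℕ) : ℂ)))) - 1))) := by
  set N : ℕ := 2 * e + 1 with hN
  have hN0 : (N : ℂ) ≠ 0 := by norm_cast
  have ha0 : (a : ℂ) ≠ 0 := by exact_mod_cast ha.ne'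
  set b : ℤ → ℂ := fun j =>
    a * Complex.exp (-(Complex.I * Real.pi * (j : ℂ)) / (2 * (N : ℂ))) with hb
  have hbre : ∀ j ∈ stepTwoIndices N, 0 < (b j).re := fun j hj => by
    simp only [hb, Complex.re_ofReal_mul]
    exact mul_pos ha (rotation_re_pos hj)
  have hb0 : ∀ j, b j ≠ 0 := fun j => mul_ne_zero ha0 (Complex.exp_ne_zero _)
  set s : ℤ → ℂ := fun j => Complex.exp (Complex.I * Real.pi * (j : ℂ) / 2) with hs
  have hsk : ∀ k : ℕ, s (2 * (k : ℤ) - ((N : ℤ) - 1)) = (-1) ^ e * (-1) ^ k := fun k => by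
    have h1 : Complex.I * Real.pi * ((2 * (k : ℤ) - ((N : ℤ) - 1) : ℤ) : ℂ) / 2 =
        k * (Real.pi * Complex.I) - e * (Real.pi * Complex.I) := by
      rw [hN]; push_cast; ring
    simp only [hs]
    rw [h1, Complex.exp_sub, Complex.exp_nat_mul, Complex.exp_nat_mul, Complex.exp_pi_mul_I]
    rcases neg_one_pow_eq_or ℂ e with h | h <;> rw [h] <;> ring
  -- As `N` is odd, each `j` is even, so `exp(-iπj/2)` and `exp(iπj/2)` are the same sign.
  have hbN : ∀ k : ℕ, b (2 * (k : ℤ) - ((N : ℤ) - 1)) ^ N =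
      a ^ N * s (2 * (k : ℤ) - ((N : ℤ) - 1)) := fun k => by
    rw [hsk]
    simp only [hb]
    rw [mul_pow, ← Complex.exp_nat_mul]
    have h1 : (N : ℂ) * (-(Complex.I * Real.pi * ((2 * (k : ℤ) - ((N : ℤ) - 1) : ℤ) : ℂ)) /
        (2 * (N : ℂ))) = e * (Real.pi * Complex.I) - k * (Real.pi * Complex.I) := by
      field_simp
      rw [hN]; push_cast; ring
    rw [h1, Complex.exp_sub, Complex.exp_nat_mul, Complex.exp_nat_mul, Complex.exp_pi_mul_I]
    rcases neg_one_pow_eq_or ℂ k with h | h <;> rw [h] <;> ring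
  set ω : ℂ := Complex.exp (2 * Real.pi * Complex.I / N) with hω
  have hprim : IsPrimitiveRoot ω⁻¹ N := (Complex.isPrimitiveRoot_exp N (by omega)).inv
  -- Raising `j` by `2` multiplies `b j ^ 2` by `ω⁻¹`; starting at the lowest index, the points `-(b
  -- j) ^ 2` run through all `N`-th roots of `-a ^ (2 * N)`.
  set v : ℂ := -(b (-((N : ℤ) - 1))) ^ 2 with hv
  have hroot : ∀ k : ℕ, v * ω⁻¹ ^ k = -(b (2 * (k : ℤ) - ((N : ℤ) - 1))) ^ 2 := fun k => by
    simp only [hv, hb, hω]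
    rw [← Complex.exp_neg, ← Complex.exp_nat_mul, mul_pow, mul_pow, ← Complex.exp_nat_mul,
      ← Complex.exp_nat_mul, neg_mul, mul_assoc, ← Complex.exp_add]
    congr 3
    push_cast
    field_simp
    ring
  have hvN : v ^ N = -(a : ℂ) ^ (2 * N) := by
    have h1 := hbN 0
    rw [hsk] at h1
    simp only [Nat.cast_zero, mul_zero, zero_sub] at h1
    have hodd : Odd N := ⟨e, hN⟩
    rw [hv, hodd.neg_pow, ← pow_mul, mul_comm 2 N, pow_mul, h1]
    rcases neg_one_pow_eq_or ℂ e with h | h <;> rw [h] <;> ring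
  -- the partial fraction decomposition, as an identity in `w`
  have hpf : ∀ w : ℂ, (∀ j ∈ stepTwoIndices N, w + b j ^ 2 ≠ 0) →
      (w ^ N + (a : ℂ) ^ (2 * N)) *
        ∑ j ∈ stepTwoIndices N, (-1) ^ e * (b j * s j) / (N * (a : ℂ) ^ N) / (w + b j ^ 2) =
      w ^ e := by
    intro w hw
    have hmem : ∀ k ∈ Finset.range N, 2 * (k : ℤ) - ((N : ℤ) - 1) ∈ stepTwoIndices N :=
      fun k hk => Finset.mem_image_of_mem _ hk
    have h := hprim.sum_pow_succ_div_sub (q := e) (by omega) v w (fun k hk => by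
      rw [hroot, sub_neg_eq_add]; exact hw _ (hmem k hk))
    rw [hvN, sub_neg_eq_add] at h
    rw [sum_stepTwoIndices]
    have haN : (a : ℂ) ^ N ≠ 0 := pow_ne_zero _ ha0
    have hterm : ∀ k ∈ Finset.range N, (v * ω⁻¹ ^ k) ^ (e + 1) / (w - v * ω⁻¹ ^ k) =
        -(N * (a : ℂ) ^ (2 * N)) * ((-1) ^ e * (b (2 * (k : ℤ) - ((N : ℤ) - 1)) *
          s (2 * (k : ℤ) - ((N : ℤ) - 1))) / (N * (a : ℂ) ^ N) /
            (w + b (2 * (k : ℤ) - ((N : ℤ) - 1)) ^ 2)) := fun k hk => by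
      have hd := hw _ (hmem k hk)
      rw [hroot, sub_neg_eq_add, neg_pow, ← pow_mul, show 2 * (e + 1) = N + 1 by omega,
        pow_succ (b _), hbN, two_mul N, pow_add (a : ℂ) N N, pow_succ (-1 : ℂ)]
      generalize (a : ℂ) ^ N = α at haN ⊢
      field_simp
    rw [Finset.sum_congr rfl hterm, ← Finset.mul_sum] at h
    have hne : (-(N * (a : ℂ) ^ (2 * N))) ≠ 0 :=
      neg_ne_zero.2 (mul_ne_zero hN0 (pow_ne_zero _ ha0))
    apply mul_left_cancel₀ hne
    linear_combination h
  have hnat : ∀ n : ℕ, ∀ j ∈ stepTwoIndices N, ((n : ℂ) + 1) ^ 2 + b j ^ 2 ≠ 0 := by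
    intro n j hj h
    have hfac : (((n : ℂ) + 1) * Complex.I + b j) * (-(((n : ℂ) + 1) * Complex.I) + b j) = 0 := by
      linear_combination h - ((n : ℂ) + 1) ^ 2 * Complex.I_mul_I
    have hre := hbre j hj
    rcases mul_eq_zero.1 hfac with h1 | h1
    · have := congrArg Complex.re h1
      simp at this
      linarith
    · have := congrArg Complex.re h1
      simp at this
      linarith
  have hsum := hasSum_sum (s := stepTwoIndices N) fun j hj =>
    (Complex.hasSum_inv_sq_add_sq (hbre j hj)).mul_left ((-1) ^ e * (b j * s j) / (N * (a : ℂ) ^ N))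
  have hfun : (fun n : ℕ => ((n : ℂ) + 1) ^ (2 * e) /
      (((n : ℂ) + 1) ^ (2 * N) + (a : ℂ) ^ (2 * N))) = fun n : ℕ =>
      ∑ j ∈ stepTwoIndices N, (-1) ^ e * (b j * s j) / (N * (a : ℂ) ^ N) *
        (1 / (((n : ℂ) + 1) ^ 2 + b j ^ 2)) := by
    ext n
    have h := hpf (((n : ℂ) + 1) ^ 2) (hnat n)
    have hpos : ((n : ℂ) + 1) ^ (2 * N) + (a : ℂ) ^ (2 * N) ≠ 0 := by
      have : (0 : ℝ) < ((n : ℝ) + 1) ^ (2 * N) + a ^ (2 * N) := by positivity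
      exact_mod_cast this.ne'
    rw [← pow_mul, ← pow_mul] at h
    rw [div_eq_iff hpos, ← h, mul_comm]
    simp only [mul_one_div]
  rw [hfun]
  refine Eq.subst (motive := fun y => HasSum _ y) ?_ hsum
  symm
  -- The partial fraction identity at `w = 0` cancels the `1 / (2 b^2)` terms of the coth
  -- expansions; this needs `e ≥ 1`.
  have hzero : ∑ j ∈ stepTwoIndices N, (-1) ^ e * (b j * s j) / (N * (a : ℂ) ^ N) / b j ^ 2 = 0 := by
    have h := hpf 0 (fun j _ => by rw [zero_add]; exact pow_ne_zero _ (hb0 j))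
    rw [zero_pow (by omega), zero_pow (by omega), zero_add] at h
    simpa [ha0] using h
  have hsign : ∑ j ∈ stepTwoIndices N, s j = (-1) ^ e := by
    rw [sum_stepTwoIndices, Finset.sum_congr rfl fun k _ => hsk k, ← Finset.mul_sum]
    have : ∑ k ∈ Finset.range N, (-1 : ℂ) ^ k = 1 := by
      rw [hN, Finset.sum_range_succ, neg_one_geom_sum]
      simp
    rw [this, mul_one]
  have hsplit : ∀ j ∈ stepTwoIndices N, (-1) ^ e * (b j * s j) / (N * (a : ℂ) ^ N) *
      (Real.pi / (2 * b j) + Real.pi / b j / (Complex.exp (2 * Real.pi * b j) - 1) -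
        1 / (2 * b j ^ 2)) =
      Real.pi * (-1) ^ e / (2 * N * (a : ℂ) ^ N) * s j +
      Real.pi * (-1) ^ e / (N * (a : ℂ) ^ N) * (s j / (Complex.exp (2 * Real.pi * b j) - 1)) -
      1 / 2 * ((-1) ^ e * (b j * s j) / (N * (a : ℂ) ^ N) / b j ^ 2) := fun j _ => by
    have := hb0 j
    have h1 : (-1) ^ e * (b j * s j) / (N * (a : ℂ) ^ N) * (Real.pi / (2 * b j)) =
        Real.pi * (-1) ^ e / (2 * N * (a : ℂ) ^ N) * s j := by
      field_simp
    have h2 : (-1) ^ e * (b j * s j) / (N * (a : ℂ) ^ N) *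
        (Real.pi / b j / (Complex.exp (2 * Real.pi * b j) - 1)) =
        Real.pi * (-1) ^ e / (N * (a : ℂ) ^ N) * (s j / (Complex.exp (2 * Real.pi * b j) - 1)) := by
      generalize Complex.exp (2 * Real.pi * b j) - 1 = E
      rw [div_mul_div_comm, mul_div_assoc', div_mul_eq_mul_div, mul_div_assoc', div_div, div_div]
      field_simp
    rw [mul_sub, mul_add, h1, h2]
    ring
  rw [Finset.sum_congr rfl hsplit, Finset.sum_sub_distrib, Finset.sum_add_distrib,
    ← Finset.mul_sum, ← Finset.mul_sum, ← Finset.mul_sum, hzero, hsign]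
  have hee : ((-1 : ℂ) ^ e) * (-1) ^ e = 1 := by
    rw [← mul_pow]; simp
  simp only [hb, hs, ← mul_assoc]
  rw [mul_zero, sub_zero, mul_add]
  congr 1
  · field_simp
    linear_combination -hee
  · field_simp


/-! ### Estimates for the kernel and its antiderivative. -/

/-- The kernel `c t ^ d / (t ^ (2 d + 2) + (c m) ^ 2)`. -/
noncomputable def lambertKernel (d : ℕ) (c m t : ℝ) : ℝ :=
  c * t ^ d / (t ^ (2 * d + 2) + (c * m) ^ 2)

/-- An antiderivative of `lambertKernel d c m`. -/
noncomputable def lambertPrimitive (d : ℕ) (c m t : ℝ) : ℝ :=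
  Real.arctan (t ^ (d + 1) / (c * m)) / ((d + 1) * m)

section Kernel

variable {d : ℕ} {c m t : ℝ}

theorem lambertKernel_nonneg (hc : 0 < c) (ht : 0 ≤ t) : 0 ≤ lambertKernel d c m t := by
  unfold lambertKernel; positivity

theorem hasDerivAt_lambertPrimitive (hc : 0 < c) (hm : 0 < m) :
    HasDerivAt (lambertPrimitive d c m) (lambertKernel d c m t) t := by
  have h1 : HasDerivAt (fun t : ℝ => t ^ (d + 1) / (c * m)) (((d + 1 : ℕ) : ℝ) * t ^ d / (c * m)) t :=
    (hasDerivAt_pow (d + 1) t).div_const _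
  have h2 := (h1.arctan).div_const ((d + 1) * m)
  refine h2.congr_deriv ?_
  have e : t ^ (2 * d + 2) = (t ^ (d + 1)) ^ 2 := by rw [← pow_mul]; ring_nf
  have hD : 0 < (t ^ (d + 1)) ^ 2 + (c * m) ^ 2 := by positivity
  have hD' : 0 < 1 + (t ^ (d + 1) / (c * m)) ^ 2 := by positivity
  rw [lambertKernel, e]
  push_cast
  have e2 : 1 + (t ^ (d + 1) / (c * m)) ^ 2 = ((t ^ (d + 1)) ^ 2 + (c * m) ^ 2) / (c * m) ^ 2 := by
    field_simp
    ring
  rw [e2]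
  field_simp

theorem hasDerivAt_lambertKernel (hc : 0 < c) (hm : 0 < m) :
    HasDerivAt (lambertKernel d c m)
      (((c * (d * t ^ (d - 1))) * (t ^ (2 * d + 2) + (c * m) ^ 2) -
        c * t ^ d * (((2 * d + 2 : ℕ) : ℝ) * t ^ (2 * d + 1))) /
          (t ^ (2 * d + 2) + (c * m) ^ 2) ^ 2) t := by
  have e : t ^ (2 * d + 2) = (t ^ (d + 1)) ^ 2 := by rw [← pow_mul]; ring_nf
  have hD : t ^ (2 * d + 2) + (c * m) ^ 2 ≠ 0 := by rw [e]; positivity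
  exact ((hasDerivAt_pow d t).const_mul c).div ((hasDerivAt_pow (2 * d + 2) t).add_const _) hD

/-- Differentiating the numerator costs a factor `d / t`, the denominator at most `(2 d + 2) / t`;
hence `3 d + 2`. -/
theorem abs_deriv_lambertKernel_le (hc : 0 < c) (hm : 0 < m) (ht : 0 < t) :
    |deriv (lambertKernel d c m) t| ≤ (3 * d + 2) * (lambertKernel d c m t / t) := by
  rw [(hasDerivAt_lambertKernel hc hm).deriv]
  set D := t ^ (2 * d + 2) + (c * m) ^ 2 with hDdef
  have hD : 0 < D := by positivity
  have h1 : (d : ℝ) * t ^ (d - 1) = d * t ^ d / t := by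
    rcases d with _ | d
    · simp
    · rw [Nat.add_sub_cancel, pow_succ]; field_simp
  have h2 : t ^ (2 * d + 1) = t ^ (2 * d + 2) / t := by rw [pow_succ t (2 * d + 1)]; field_simp
  have h3 : t ^ (2 * d + 2) ≤ D := by rw [hDdef]; nlinarith [sq_nonneg (c * m)]
  have e : (c * (d * t ^ (d - 1)) * D - c * t ^ d * (((2 * d + 2 : ℕ) : ℝ) * t ^ (2 * d + 1))) / D ^ 2 =
      c * t ^ d / (t * D) * d - c * t ^ d / (t * D) * ((2 * d + 2) * (t ^ (2 * d + 2) / D)) := by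
    rw [h1, h2]
    push_cast
    field_simp
  have e' : (3 * d + 2) * (lambertKernel d c m t / t) =
      c * t ^ d / (t * D) * d + c * t ^ d / (t * D) * (2 * d + 2) := by
    rw [lambertKernel, ← hDdef]
    field_simp
    ring
  rw [e, e']
  have h4 : t ^ (2 * d + 2) / D ≤ 1 := (div_le_one hD).2 h3
  have h5 : 0 ≤ t ^ (2 * d + 2) / D := by positivity
  have hA : 0 ≤ c * t ^ d / (t * D) := by positivity
  refine (abs_sub _ _).trans ?_
  rw [abs_of_nonneg (by positivity), abs_of_nonneg (by positivity)]
  gcongr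
  nlinarith

/-- Young's inequality separates the two variables of the kernel. -/
theorem lambertKernel_le (hc : 0 < c) (hm : 0 < m) (ht : 0 < t) :
    lambertKernel d c m t ≤
      c * (t ^ (-(1 / 2) : ℝ) * (c * m) ^ (-(1 + 1 / (2 * (d + 1))) : ℝ)) := by
  -- Chosen so that `(d + 1)(1 - δ) = d + 1/2`: the bound decays like `t^(-1/2)` while the exponent
  -- of `m` stays below `-1`.
  set δ : ℝ := 1 / (2 * (d + 1)) with hδ
  have hδ0 : 0 < δ := by positivity
  have hδ1 : δ ≤ 1 / 2 := by
    rw [hδ]; gcongr; linarith [(Nat.cast_nonneg d : (0 : ℝ) ≤ d)]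
  have hcm : 0 < c * m := by positivity
  have hy := Real.geom_mean_le_arith_mean2_weighted (w₁ := (1 - δ) / 2) (w₂ := (1 + δ) / 2)
    (p₁ := t ^ (2 * d + 2)) (p₂ := (c * m) ^ 2) (by linarith) (by linarith) (by positivity)
    (by positivity) (by ring)
  have hD : (t ^ (2 * d + 2)) ^ ((1 - δ) / 2) * ((c * m) ^ 2) ^ ((1 + δ) / 2) ≤
      t ^ (2 * d + 2) + (c * m) ^ 2 := by
    refine hy.trans ?_
    have h1 : 0 < t ^ (2 * d + 2) := by positivity
    have h2 : 0 < (c * m) ^ 2 := by positivity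
    nlinarith
  have e1 : (t ^ (2 * d + 2)) ^ ((1 - δ) / 2) = t ^ d * t ^ (1 / 2 : ℝ) := by
    rw [← Real.rpow_natCast, ← Real.rpow_mul ht.le, ← Real.rpow_natCast t d, ← Real.rpow_add ht]
    congr 1
    rw [hδ]; push_cast; field_simp; ring
  have e2 : ((c * m) ^ 2) ^ ((1 + δ) / 2) = (c * m) ^ (1 + δ) := by
    rw [← Real.rpow_natCast, ← Real.rpow_mul hcm.le]
    congr 1
    push_cast; ring
  rw [e1, e2] at hD
  rw [lambertKernel, Real.rpow_neg ht.le, Real.rpow_neg hcm.le]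
  have p1 : 0 < t ^ (1 / 2 : ℝ) := by positivity
  have p2 : 0 < (c * m) ^ (1 + δ) := by positivity
  calc c * t ^ d / (t ^ (2 * d + 2) + (c * m) ^ 2)
      ≤ c * t ^ d / (t ^ d * t ^ (1 / 2 : ℝ) * (c * m) ^ (1 + δ)) := by gcongr
    _ = _ := by field_simp

theorem lambertKernel_le_div_sq (hc : 0 < c) (hm : 0 < m) (ht : 0 ≤ t) :
    lambertKernel d c m t ≤ t ^ d / c * (1 / m ^ 2) := by
  rw [lambertKernel]
  calc c * t ^ d / (t ^ (2 * d + 2) + (c * m) ^ 2) ≤ c * t ^ d / (c * m) ^ 2 := by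
        gcongr
        have : 0 ≤ t ^ (2 * d + 2) := by positivity
        linarith
    _ = _ := by field_simp

theorem arctan_le_self {u : ℝ} (hu : 0 ≤ u) : Real.arctan u ≤ u := by
  have h0 : 0 ≤ Real.arctan u := Real.arctan_nonneg.2 hu
  calc Real.arctan u ≤ Real.tan (Real.arctan u) :=
        Real.le_tan h0 (Real.arctan_lt_pi_div_two u)
    _ = u := Real.tan_arctan u

theorem lambertPrimitive_nonneg (hc : 0 < c) (hm : 0 < m) (ht : 0 ≤ t) :
    0 ≤ lambertPrimitive d c m t := by
  have := Real.arctan_nonneg.2 (show 0 ≤ t ^ (d + 1) / (c * m) by positivity)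
  unfold lambertPrimitive; positivity

theorem lambertPrimitive_le_div_sq (hc : 0 < c) (hm : 0 < m) (ht : 0 ≤ t) :
    lambertPrimitive d c m t ≤ t ^ (d + 1) / (c * (d + 1)) * (1 / m ^ 2) := by
  have := arctan_le_self (show 0 ≤ t ^ (d + 1) / (c * m) by positivity)
  rw [lambertPrimitive]
  calc Real.arctan (t ^ (d + 1) / (c * m)) / ((d + 1) * m)
      ≤ t ^ (d + 1) / (c * m) / ((d + 1) * m) := by gcongr
    _ = _ := by field_simp

/-- The error of the right-endpoint rule on `[n, n + 1]`. -/
theorem abs_lambertKernel_sub_primitive_le (hc : 0 < c) (hm : 0 < m) {n : ℝ} (hn : 0 < n) :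
    |lambertKernel d c m (n + 1) - (lambertPrimitive d c m (n + 1) - lambertPrimitive d c m n)| ≤
      (3 * d + 2) * c * (n ^ (-(3 / 2) : ℝ) * (c * m) ^ (-(1 + 1 / (2 * (d + 1))) : ℝ)) := by
  -- Two mean value theorems: the error is `K(n + 1) - K(ξ) = K'(η) (n + 1 - ξ)`.
  obtain ⟨ξ, ⟨hξ1, hξ2⟩, hξ⟩ := exists_hasDerivAt_eq_slope (lambertPrimitive d c m)
    (lambertKernel d c m) (lt_add_one n)
    (fun y _ => (hasDerivAt_lambertPrimitive hc hm).continuousAt.continuousWithinAt)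
    (fun y _ => hasDerivAt_lambertPrimitive hc hm)
  rw [add_sub_cancel_left, div_one] at hξ
  rw [← hξ]
  obtain ⟨η, ⟨hη1, hη2⟩, hη⟩ := exists_deriv_eq_slope (lambertKernel d c m) hξ2
    (fun y _ => (hasDerivAt_lambertKernel hc hm).continuousAt.continuousWithinAt)
    (fun y _ => (hasDerivAt_lambertKernel hc hm).differentiableAt.differentiableWithinAt)
  have hη0 : 0 < η := by linarith
  have hpos : 0 < n + 1 - ξ := by linarith
  rw [eq_div_iff hpos.ne'] at hη
  rw [← hη, abs_mul, abs_of_pos hpos]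
  have hb := abs_deriv_lambertKernel_le (d := d) hc hm hη0
  have hcm : 0 < c * m := by positivity
  calc |deriv (lambertKernel d c m) η| * (n + 1 - ξ)
      ≤ |deriv (lambertKernel d c m) η| * 1 := by gcongr; linarith
    _ ≤ (3 * d + 2) * (lambertKernel d c m η / η) := by rw [mul_one]; exact hb
    _ ≤ (3 * d + 2) * (c * (η ^ (-(1 / 2) : ℝ) * (c * m) ^ (-(1 + 1 / (2 * (d + 1))) : ℝ)) / η) := by
        gcongr; exact lambertKernel_le hc hm hη0
    _ = (3 * d + 2) * c * (η ^ (-(3 / 2) : ℝ) * (c * m) ^ (-(1 + 1 / (2 * (d + 1))) : ℝ)) := by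
        have : η ^ (-(3 / 2) : ℝ) = η ^ (-(1 / 2) : ℝ) / η := by
          rw [← Real.rpow_sub_one hη0.ne']; norm_num
        rw [this]; ring
    _ ≤ _ := by
        have : η ^ (-(3 / 2) : ℝ) ≤ n ^ (-(3 / 2) : ℝ) :=
          Real.rpow_le_rpow_of_nonpos hn (by linarith) (by norm_num)
        gcongr

end Kernel

/-! ### Absolute summability of the defects and interchange of the sums. -/

section DoubleSum

variable {d : ℕ} {c : ℝ}

/-- The `n`-th error of the right-endpoint rule for the kernel with parameter `m + 1`. -/
noncomputable def lambertDefect (d : ℕ) (c : ℝ) (n m : ℕ) : ℝ :=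
  lambertKernel d c (m + 1) (n + 1) -
    (lambertPrimitive d c (m + 1) (n + 1) - lambertPrimitive d c (m + 1) n)

/-- The series `∑ arctan (y / m) / m` over `m ≥ 1`. -/
noncomputable def arctanSeries (y : ℝ) : ℝ :=
  ∑' m : ℕ, Real.arctan (y / (m + 1)) / (m + 1)

theorem lambertPrimitive_zero (m : ℝ) : lambertPrimitive d c m 0 = 0 := by
  simp [lambertPrimitive]

theorem summable_one_div_succ_sq : Summable fun m : ℕ => 1 / ((m : ℝ) + 1) ^ 2 := by
  have := (summable_nat_add_iff 1).2 (Real.summable_one_div_nat_pow.2 one_lt_two)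
  simpa using this

theorem summable_succ_rpow {r : ℝ} (hr : r < -1) : Summable fun m : ℕ => ((m : ℝ) + 1) ^ r := by
  have := (summable_nat_add_iff 1).2 (Real.summable_nat_rpow.2 hr)
  simpa using this

theorem summable_lambertDefect (hc : 0 < c) :
    Summable fun p : ℕ × ℕ => lambertDefect d c p.1 p.2 := by
  set r : ℝ := -(1 + 1 / (2 * (d + 1))) with hr
  have hr1 : r < -1 := by
    have : (0 : ℝ) < 1 / (2 * (d + 1)) := by positivity
    rw [hr]; linarith
  -- The mean value bound excludes `n = 0`, where `0 ^ (-3/2)` is `0` by convention; the extra term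
  -- `2 / c` covers that row.
  have hA : Summable fun n : ℕ => (3 * d + 2) * c * c ^ r * (n : ℝ) ^ (-(3 / 2) : ℝ) +
      if n = 0 then 2 / c else 0 :=
    ((Real.summable_nat_rpow.2 (by norm_num)).mul_left _).add
      (summable_of_ne_finset_zero (s := {0}) fun b hb => by simp at hb; simp [hb])
  have hB : Summable fun m : ℕ => 1 / ((m : ℝ) + 1) ^ 2 + ((m : ℝ) + 1) ^ r :=
    summable_one_div_succ_sq.add (summable_succ_rpow hr1)
  refine Summable.of_norm_bounded (hA.mul_of_nonneg hB (fun n => ?_) (fun m => ?_)) ?_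
  · have : (0 : ℝ) ≤ if n = 0 then 2 / c else 0 := by split_ifs <;> positivity
    simp only [Pi.zero_apply]; positivity
  · simp only [Pi.zero_apply]; positivity
  rintro ⟨n, m⟩
  have hm : (0 : ℝ) < (m : ℝ) + 1 := by positivity
  rw [Real.norm_eq_abs]
  simp only [lambertDefect]
  rcases n with _ | n
  · have h1 := lambertKernel_le_div_sq (d := d) hc hm zero_le_one
    have h2 := lambertPrimitive_le_div_sq (d := d) hc hm zero_le_one
    have h3 := lambertKernel_nonneg (d := d) (m := (m : ℝ) + 1) hc zero_le_one
    have h4 := lambertPrimitive_nonneg (d := d) hc hm zero_le_one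
    have h5 : 1 / (c * ((d : ℝ) + 1)) ≤ 1 / c := by
      gcongr
      have : (0 : ℝ) ≤ d := by positivity
      nlinarith
    have h6 : (0 : ℝ) ≤ 1 / ((m : ℝ) + 1) ^ 2 := by positivity
    rw [one_pow] at h1 h2
    have h7 : 1 / (c * ((d : ℝ) + 1)) * (1 / ((m : ℝ) + 1) ^ 2) ≤
      1 / c * (1 / ((m : ℝ) + 1) ^ 2) := by gcongr
    have h8 : (0 : ℝ) ≤ ((m : ℝ) + 1) ^ r := by positivity
    simp only [Nat.cast_zero, zero_add, lambertPrimitive_zero, sub_zero, if_true]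
    rw [Real.zero_rpow (by norm_num), mul_zero, zero_add]
    calc _ ≤ 2 / c * (1 / ((m : ℝ) + 1) ^ 2) := by
          rw [abs_le]
          have e : 2 / c * (1 / ((m : ℝ) + 1) ^ 2) = 1 / c * (1 / ((m : ℝ) + 1) ^ 2) +
            1 / c * (1 / ((m : ℝ) + 1) ^ 2) := by ring
          rw [e]
          constructor <;> linarith
      _ ≤ _ := by gcongr; linarith
  · have hn : (0 : ℝ) < ((n + 1 : ℕ) : ℝ) := by positivity
    refine (abs_lambertKernel_sub_primitive_le hc hm hn).trans ?_
    rw [Real.mul_rpow hc.le hm.le]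
    simp only [Nat.add_eq_zero_iff, one_ne_zero, and_false, if_false, add_zero]
    have h6 : (0 : ℝ) ≤ 1 / ((m : ℝ) + 1) ^ 2 := by positivity
    calc _ = (3 * d + 2) * c * c ^ r * ((n + 1 : ℕ) : ℝ) ^ (-(3 / 2) : ℝ) * ((m : ℝ) + 1) ^ r := by
          ring
      _ ≤ _ := by gcongr; linarith

theorem summable_lambertKernel_left (hc : 0 < c) {m : ℝ} (hm : 0 < m) :
    Summable fun n : ℕ => lambertKernel d c m (n + 1) := by
  refine Summable.of_nonneg_of_le (fun n => lambertKernel_nonneg hc (by positivity)) (fun n => ?_)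
    (summable_one_div_succ_sq.mul_left c)
  have ht : (1 : ℝ) ≤ (n : ℝ) + 1 := by linarith [(Nat.cast_nonneg n : (0 : ℝ) ≤ n)]
  set t := (n : ℝ) + 1
  have hd1 : 1 ≤ t ^ d := one_le_pow₀ ht
  rw [lambertKernel]
  calc c * t ^ d / (t ^ (2 * d + 2) + (c * m) ^ 2) ≤ c * t ^ d / (t ^ d * t ^ 2) := by
        gcongr
        have e : t ^ (2 * d + 2) = t ^ d * t ^ 2 * t ^ d := by ring
        have h0 : 0 ≤ t ^ d * t ^ 2 := by positivity
        have h1 : 0 ≤ (c * m) ^ 2 := by positivity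
        rw [e]
        nlinarith
    _ = _ := by field_simp

theorem summable_lambertKernel_right (hc : 0 < c) {t : ℝ} (ht : 0 ≤ t) :
    Summable fun m : ℕ => lambertKernel d c (m + 1) t :=
  Summable.of_nonneg_of_le (fun _ => lambertKernel_nonneg hc ht)
    (fun _ => lambertKernel_le_div_sq hc (by positivity) ht)
    (summable_one_div_succ_sq.mul_left _)

theorem summable_lambertPrimitive (hc : 0 < c) {t : ℝ} (ht : 0 ≤ t) :
    Summable fun m : ℕ => lambertPrimitive d c (m + 1) t :=
  Summable.of_nonneg_of_le (fun _ => lambertPrimitive_nonneg hc (by positivity) ht)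
    (fun _ => lambertPrimitive_le_div_sq hc (by positivity) ht)
    (summable_one_div_succ_sq.mul_left _)

theorem tsum_lambertPrimitive (t : ℝ) :
    ∑' m : ℕ, lambertPrimitive d c (m + 1) t = arctanSeries (t ^ (d + 1) / c) / (d + 1) := by
  rw [arctanSeries, ← tsum_div_const]
  refine tsum_congr fun m => ?_
  rw [lambertPrimitive, div_div, div_div, mul_comm ((d : ℝ) + 1)]

open Filter Topology

theorem tendsto_lambertPrimitive (hc : 0 < c) {m : ℝ} (hm : 0 < m) :
    Tendsto (fun n : ℕ => lambertPrimitive d c m n) atTop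
      (𝓝 (Real.pi / (2 * (d + 1) * m))) := by
  have h1 : Tendsto (fun n : ℕ => (n : ℝ) ^ (d + 1) / (c * m)) atTop atTop :=
    ((tendsto_pow_atTop (Nat.succ_ne_zero d)).comp tendsto_natCast_atTop_atTop).atTop_div_const
      (by positivity)
  have h2 := ((tendsto_nhdsWithin_iff.1 Real.tendsto_arctan_atTop).1.comp h1).div_const
    (((d : ℝ) + 1) * m)
  refine Eq.subst (motive := fun y => Tendsto _ _ (𝓝 y)) ?_ h2
  field_simp

/-- The primitives telescope in `n` to the integral of the kernel over `[0, ∞)`. -/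
theorem tsum_lambertDefect_left (hc : 0 < c) (m : ℕ) :
    ∑' n : ℕ, lambertDefect d c n m =
      ∑' n : ℕ, lambertKernel d c (m + 1) (n + 1) - Real.pi / (2 * (d + 1) * (m + 1)) := by
  have hm : (0 : ℝ) < (m : ℝ) + 1 := by positivity
  have hdef : Summable fun n : ℕ => lambertDefect d c n m :=
    (summable_lambertDefect (d := d) hc).comp_injective (i := fun n : ℕ => (n, m))
      fun a b h => (Prod.mk.inj h).1
  have hk := summable_lambertKernel_left (d := d) hc hm
  have hp : Summable fun n : ℕ => lambertPrimitive d c (m + 1) ((n + 1 : ℕ) : ℝ) -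
      lambertPrimitive d c (m + 1) n := by
    refine (hk.sub hdef).congr fun n => ?_
    rw [lambertDefect]; push_cast; ring
  have hpt : ∑' n : ℕ, (lambertPrimitive d c (m + 1) ((n + 1 : ℕ) : ℝ) -
      lambertPrimitive d c (m + 1) n) = Real.pi / (2 * (d + 1) * (m + 1)) := by
    refine HasSum.tsum_eq (hp.hasSum_iff_tendsto_nat.2 ?_)
    simp only [Finset.sum_range_sub (fun n : ℕ => lambertPrimitive d c (m + 1) n), Nat.cast_zero,
      lambertPrimitive_zero, sub_zero]
    exact tendsto_lambertPrimitive hc hm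
  rw [← hpt, ← hk.tsum_sub hp]
  exact tsum_congr fun n => by rw [lambertDefect]; push_cast; ring

theorem tsum_lambertDefect_right (hc : 0 < c) (n : ℕ) :
    ∑' m : ℕ, lambertDefect d c n m =
      ∑' m : ℕ, lambertKernel d c (m + 1) (n + 1) -
        (arctanSeries (((n + 1 : ℕ) : ℝ) ^ (d + 1) / c) / (d + 1) -
          arctanSeries ((n : ℝ) ^ (d + 1) / c) / (d + 1)) := by
  have hn : (0 : ℝ) ≤ (n : ℝ) + 1 := by positivity
  have h1 := summable_lambertPrimitive (d := d) hc hn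
  have h2 := summable_lambertPrimitive (d := d) hc (Nat.cast_nonneg n)
  simp only [lambertDefect]
  rw [(summable_lambertKernel_right hc hn).tsum_sub (h1.sub h2), h1.tsum_sub h2,
    tsum_lambertPrimitive, tsum_lambertPrimitive]
  push_cast
  rfl

theorem arctanSeries_zero : arctanSeries 0 = 0 := by
  simp [arctanSeries]

/-- Interchange of the two summations of the kernel, both regularized by its primitive. -/
theorem lambertKernel_interchange (d : ℕ) (hc : 0 < c) :
    (Summable fun m : ℕ => ∑' n : ℕ, lambertKernel d c (m + 1) (n + 1) -
      Real.pi / (2 * (d + 1) * (m + 1))) ∧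
    Tendsto (fun A : ℕ => ∑ n ∈ Finset.range A, ∑' m : ℕ, lambertKernel d c (m + 1) (n + 1) -
      arctanSeries ((A : ℝ) ^ (d + 1) / c) / (d + 1)) atTop
      (𝓝 (∑' m : ℕ, (∑' n : ℕ, lambertKernel d c (m + 1) (n + 1) -
        Real.pi / (2 * (d + 1) * (m + 1))))) := by
  have hs := summable_lambertDefect (d := d) hc
  have hs' : Summable fun p : ℕ × ℕ => lambertDefect d c p.2 p.1 := hs.prod_symm
  simp only [← tsum_lambertDefect_left hc]
  refine ⟨hs'.prod, ?_⟩
  have hcomm : ∑' m : ℕ, ∑' n : ℕ, lambertDefect d c n m =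
      ∑' n : ℕ, ∑' m : ℕ, lambertDefect d c n m :=
    Summable.tsum_comm (f := fun n m => lambertDefect d c n m) hs
  rw [hcomm]
  refine hs.prod.hasSum.tendsto_sum_nat.congr fun A => ?_
  simp only [tsum_lambertDefect_right hc]
  rw [Finset.sum_sub_distrib, Finset.sum_range_sub
    (fun n : ℕ => arctanSeries ((n : ℝ) ^ (d + 1) / c) / (d + 1))]
  simp [arctanSeries_zero]

/-! ### Asymptotics of the arctangent series. -/

/-- For `d = 0`, `c = 1` the kernel `1 / (t^2 + m^2)` is symmetric in `t` and `m`, so the partial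
iterated sums in the interchange coincide and only the two regularizing terms remain. -/
theorem tendsto_arctanSeries_sub_harmonic :
    Tendsto (fun A : ℕ => arctanSeries A - Real.pi / 2 * (harmonic A : ℝ)) atTop (𝓝 0) := by
  obtain ⟨h1, h2⟩ := lambertKernel_interchange 0 one_pos
  have h3 := h1.hasSum.tendsto_sum_nat.sub h2
  rw [sub_self] at h3
  refine h3.congr fun A => ?_
  have hsymm : ∀ m n : ℕ, lambertKernel 0 1 ((m : ℝ) + 1) (n + 1) =
      lambertKernel 0 1 ((n : ℝ) + 1) (m + 1) := fun m n => by
    simp [lambertKernel, add_comm]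
  rw [Finset.sum_sub_distrib]
  simp only [fun m n : ℕ => hsymm m n]
  rw [show ∀ a b c d : ℝ, d = a → a - b - (d - c) = c - b by intros; subst_vars; ring]
  · rw [harmonic]
    push_cast
    rw [Finset.mul_sum]
    simp only [zero_add, pow_one, div_one, mul_one]
    congr 1
    exact Finset.sum_congr rfl fun i _ => by field_simp
  · exact Finset.sum_congr rfl fun i _ => tsum_congr fun j => rfl

theorem arctanSeries_mono {y z : ℝ} (hy : 0 ≤ y) (hyz : y ≤ z) :
    arctanSeries y ≤ arctanSeries z := by
  have hs : ∀ w : ℝ, 0 ≤ w → Summable fun m : ℕ => Real.arctan (w / (m + 1)) / (m + 1) := by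
    intro w hw
    refine (summable_lambertPrimitive (d := 0) one_pos hw).congr fun m => ?_
    simp [lambertPrimitive]
  refine Summable.tsum_le_tsum (fun m => ?_) (hs y hy) (hs z (hy.trans hyz))
  gcongr

theorem tendsto_arctanSeries_sub_log :
    Tendsto (fun y : ℝ => arctanSeries y - Real.pi / 2 * Real.log y) atTop
      (𝓝 (Real.pi / 2 * Real.eulerMascheroniConstant)) := by
  have hlow : Tendsto (fun A : ℕ => arctanSeries A - Real.pi / 2 * Real.log ((A : ℝ) + 1)) atTop
      (𝓝 (Real.pi / 2 * Real.eulerMascheroniConstant)) := by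
    have := tendsto_arctanSeries_sub_harmonic.add
      (Real.tendsto_harmonic_sub_log_add_one.const_mul (Real.pi / 2))
    rw [zero_add] at this
    exact this.congr fun A => by ring
  have hup : Tendsto (fun A : ℕ => arctanSeries ((A + 1 : ℕ) : ℝ) - Real.pi / 2 * Real.log A) atTop
      (𝓝 (Real.pi / 2 * Real.eulerMascheroniConstant)) := by
    have h1 := tendsto_arctanSeries_sub_harmonic.add
      (Real.tendsto_harmonic_sub_log.const_mul (Real.pi / 2))
    rw [zero_add] at h1
    have h2 := h1.comp (tendsto_add_atTop_nat 1)
    have h3 : Tendsto (fun A : ℕ => Real.log ((A : ℝ) + 1) - Real.log A) atTop (𝓝 0) := by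
      have := Real.tendsto_harmonic_sub_log.sub Real.tendsto_harmonic_sub_log_add_one
      rw [sub_self] at this
      exact this.congr fun A => by ring
    have h4 := h2.add (h3.const_mul (Real.pi / 2))
    rw [mul_zero, add_zero] at h4
    refine h4.congr fun A => ?_
    simp only [Function.comp]
    push_cast
    ring
  -- Monotonicity of `arctanSeries` and `log` sandwiches real `y` between `⌊y⌋₊` and `⌊y⌋₊ + 1`.
  have hfl : Tendsto (fun y : ℝ => ⌊y⌋₊) atTop atTop := tendsto_nat_floor_atTop
  refine tendsto_of_tendsto_of_tendsto_of_le_of_le' (hlow.comp hfl) (hup.comp hfl) ?_ ?_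
  · filter_upwards [eventually_ge_atTop 1] with y hy
    have hy0 : 0 < y := by linarith
    simp only [Function.comp]
    have h1 := arctanSeries_mono (Nat.cast_nonneg _) (Nat.floor_le hy0.le)
    have h2 := Real.log_le_log hy0 (Nat.lt_floor_add_one y).le
    have := mul_le_mul_of_nonneg_left h2 (by positivity : 0 ≤ Real.pi / 2)
    linarith
  · filter_upwards [eventually_ge_atTop 1] with y hy
    have hy0 : 0 < y := by linarith
    have hf : (0 : ℝ) < (⌊y⌋₊ : ℝ) := by exact_mod_cast Nat.floor_pos.2 hy
    simp only [Function.comp]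
    have h1 := arctanSeries_mono hy0.le (Nat.lt_floor_add_one y).le
    have h2 := Real.log_le_log hf (Nat.floor_le hy0.le)
    have := mul_le_mul_of_nonneg_left h2 (by positivity : 0 ≤ Real.pi / 2)
    push_cast
    linarith

end DoubleSum

/-! ### The Lambert series from the row sums. -/

open Filter Topology

theorem Real.hasSum_inv_sq_add_sq {b : ℝ} (hb : 0 < b) :
    HasSum (fun n : ℕ => 1 / (((n : ℝ) + 1) ^ 2 + b ^ 2))
      (Real.pi / (2 * b) + Real.pi / b / (Real.exp (2 * Real.pi * b) - 1) - 1 / (2 * b ^ 2)) := by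
  have h := Complex.hasSum_inv_sq_add_sq (b := (b : ℂ)) (by simpa using hb)
  exact_mod_cast h

theorem tsum_lambertKernel_right (d : ℕ) {x t : ℝ} (hx : 0 < x) (ht : 0 < t) :
    ∑' m : ℕ, lambertKernel d (2 * Real.pi / x) (m + 1) t =
      Real.pi * (1 / (t * (Real.exp (t ^ (d + 1) * x) - 1))) + Real.pi / 2 * t⁻¹ -
        Real.pi / x * (1 / t ^ (d + 2)) := by
  have hpi := Real.pi_pos
  -- This `b` makes `2 * π * b` the Lambert exponent `t ^ (d + 1) * x`.
  have hb : 0 < t ^ (d + 1) * x / (2 * Real.pi) := by positivity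
  have h := (Real.hasSum_inv_sq_add_sq hb).mul_left (t ^ d * x / (2 * Real.pi))
  have e1 : 2 * Real.pi * (t ^ (d + 1) * x / (2 * Real.pi)) = t ^ (d + 1) * x := by field_simp
  rw [e1] at h
  have hE : Real.exp (t ^ (d + 1) * x) - 1 ≠ 0 :=
    (sub_pos.2 (Real.one_lt_exp_iff.2 (by positivity))).ne'
  generalize Real.exp (t ^ (d + 1) * x) - 1 = E at h hE ⊢
  have hfun : (fun m : ℕ => lambertKernel d (2 * Real.pi / x) (m + 1) t) = fun m : ℕ =>
      t ^ d * x / (2 * Real.pi) *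
        (1 / (((m : ℝ) + 1) ^ 2 + (t ^ (d + 1) * x / (2 * Real.pi)) ^ 2)) := by
    ext m
    have e : t ^ (2 * d + 2) = (t ^ (d + 1)) ^ 2 := by rw [← pow_mul]; ring_nf
    rw [lambertKernel, e, mul_one_div, div_eq_div_iff (by positivity) (by positivity)]
    field_simp
    ring
  rw [hfun, h.tsum_eq]
  field_simp
  ring

/-- The Lambert series in terms of the regularized column sums of the kernel. -/
theorem tsum_lambert_eq (d : ℕ) {x : ℝ} (hx : 0 < x) :
    (Summable fun n : ℕ => 1 / (((n : ℝ) + 1) * (Real.exp (((n : ℝ) + 1) ^ (d + 1) * x) - 1))) ∧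
    ∑' n : ℕ, 1 / (((n : ℝ) + 1) * (Real.exp (((n : ℝ) + 1) ^ (d + 1) * x) - 1)) =
      1 / (2 * ((d : ℝ) + 1)) * (Real.eulerMascheroniConstant * (1 - ((d : ℝ) + 1)) +
        Real.log (x / (2 * Real.pi))) + (∑' n : ℕ, 1 / ((n : ℝ) + 1) ^ (d + 2)) / x +
      1 / Real.pi * ∑' m : ℕ, (∑' n : ℕ, lambertKernel d (2 * Real.pi / x) (m + 1) (n + 1) -
        Real.pi / (2 * (d + 1) * (m + 1))) := by
  have hpi := Real.pi_pos
  have hc : 0 < 2 * Real.pi / x := by positivity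
  have hz : Summable fun n : ℕ => 1 / ((n : ℝ) + 1) ^ (d + 2) := by
    have := (summable_nat_add_iff 1).2 (Real.summable_one_div_nat_pow.2 (by omega : 1 < d + 2))
    simpa using this
  have hu : Summable fun n : ℕ =>
      1 / (((n : ℝ) + 1) * (Real.exp (((n : ℝ) + 1) ^ (d + 1) * x) - 1)) := by
    have hE : ∀ n : ℕ, ((n : ℝ) + 1) ^ (d + 1) * x ≤ Real.exp (((n : ℝ) + 1) ^ (d + 1) * x) - 1 :=
      fun n => by linarith [Real.add_one_le_exp (((n : ℝ) + 1) ^ (d + 1) * x)]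
    have hp : ∀ n : ℕ, 0 < ((n : ℝ) + 1) ^ (d + 1) * x := fun n => by positivity
    refine Summable.of_nonneg_of_le (fun n => ?_) (fun n => ?_) (hz.mul_left (1 / x))
    · have := (hp n).trans_le (hE n)
      positivity
    · calc _ ≤ 1 / (((n : ℝ) + 1) * (((n : ℝ) + 1) ^ (d + 1) * x)) := by
            have := hp n
            gcongr
            exact hE n
        _ = _ := by rw [pow_succ _ (d + 1)]; field_simp
  refine ⟨hu, ?_⟩
  have hlim := (lambertKernel_interchange d hc).2
  set S := ∑' m : ℕ, (∑' n : ℕ, lambertKernel d (2 * Real.pi / x) (m + 1) (n + 1) -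
        Real.pi / (2 * (d + 1) * (m + 1)))
  have hN : (0 : ℝ) < (d : ℝ) + 1 := by positivity
  have harg : Tendsto (fun A : ℕ => (A : ℝ) ^ (d + 1) / (2 * Real.pi / x)) atTop atTop :=
    ((tendsto_pow_atTop (Nat.succ_ne_zero d)).comp tendsto_natCast_atTop_atTop).atTop_div_const hc
  have h1 := (tendsto_arctanSeries_sub_log.comp harg).div_const ((d : ℝ) + 1)
  have h2 := Real.tendsto_harmonic_sub_log.const_mul (Real.pi / 2)
  have h3 := hu.hasSum.tendsto_sum_nat.const_mul Real.pi
  have h4 := hz.hasSum.tendsto_sum_nat.const_mul (Real.pi / x)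
  -- As `log(A^(d+1) / c) / (d + 1) = log A - log c / (d + 1)`, the `log A` terms cancel and the
  -- added constant compensates for `log c`.
  have h5 := ((h3.sub h4).add (h2.sub h1)).add_const
    (Real.pi / (2 * ((d : ℝ) + 1)) * Real.log (2 * Real.pi / x))
  have huniq := tendsto_nhds_unique hlim (h5.congr' ?_)
  · have hlog : Real.log (2 * Real.pi / x) = -Real.log (x / (2 * Real.pi)) := by
      rw [← Real.log_inv, inv_div]
    rw [hlog] at huniq
    rw [huniq]
    field_simp
    ring
  · filter_upwards [eventually_ge_atTop 1] with A hA
    have hA0 : (0 : ℝ) < A := by exact_mod_cast hA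
    simp only [Function.comp]
    rw [Real.log_div (by positivity) hc.ne', Real.log_pow]
    have hsum : ∑ n ∈ Finset.range A, ∑' m : ℕ,
        lambertKernel d (2 * Real.pi / x) (m + 1) ((n : ℝ) + 1) =
        Real.pi * ∑ n ∈ Finset.range A,
          1 / (((n : ℝ) + 1) * (Real.exp (((n : ℝ) + 1) ^ (d + 1) * x) - 1)) +
        Real.pi / 2 * (harmonic A : ℝ) -
        Real.pi / x * ∑ n ∈ Finset.range A, 1 / ((n : ℝ) + 1) ^ (d + 2) := by
      rw [Finset.sum_congr rfl fun n _ => tsum_lambertKernel_right d hx (by positivity),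
        Finset.sum_sub_distrib, Finset.sum_add_distrib, ← Finset.mul_sum, ← Finset.mul_sum,
        ← Finset.mul_sum, harmonic]
      push_cast
      rfl
    rw [hsum]
    push_cast
    field_simp
    ring

/-! ### The rotated series and the final identity. -/

/-- `‖exp w - 1‖ ≥ exp(w.re) - 1 ≥ w.re`, and `w.re` is a positive multiple of `n^(1/N)`, so the
terms are `O(n^(-1 - 1/N))`. -/
theorem summable_rotatedLambertTerm {N : ℕ} {x : ℝ} (hx : 0 < x) {j : ℤ}
    (hj : j ∈ stepTwoIndices N) : Summable (rotatedLambertTerm N x j) := by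
  have hN : 0 < N := by
    have := abs_lt_of_mem_stepTwoIndices hj
    omega
  have hpi := Real.pi_pos
  set ρ := (Complex.exp (-(Complex.I * Real.pi * (j : ℂ)) / (2 * (N : ℂ)))).re with hρ
  have hρ0 : 0 < ρ := rotation_re_pos hj
  have hs : Summable fun n : ℕ+ => 1 / (2 * Real.pi * ρ * (2 * Real.pi / x) ^ ((1 : ℝ) / N)) *
      (((n : ℕ) : ℝ) ^ (-(1 + 1 / (N : ℝ)))) := by
    have h1 : Summable fun n : ℕ => (n : ℝ) ^ (-(1 + 1 / (N : ℝ))) :=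
      Real.summable_nat_rpow.2 (by
        have : (0 : ℝ) < 1 / N := by positivity
        linarith)
    exact (h1.comp_injective PNat.coe_injective).mul_left _
  refine Summable.of_norm_bounded hs fun n => ?_
  have hn : (0 : ℝ) < ((n : ℕ) : ℝ) := by exact_mod_cast n.pos
  rw [rotatedLambertTerm]
  set a : ℝ := (2 * Real.pi * ((n : ℕ) : ℝ) / x) ^ ((1 : ℝ) / N) with ha
  have ha0 : 0 < a := by positivity
  set w : ℂ := 2 * Real.pi * (a : ℂ) *
    Complex.exp (-(Complex.I * Real.pi * (j : ℂ)) / (2 * (N : ℂ))) with hw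
  have hwre : w.re = 2 * Real.pi * a * ρ := by
    have : w = ((2 * Real.pi * a : ℝ) : ℂ) *
        Complex.exp (-(Complex.I * Real.pi * (j : ℂ)) / (2 * (N : ℂ))) := by
      rw [hw]; push_cast; ring
    rw [this, Complex.re_ofReal_mul]
  have hden : 2 * Real.pi * a * ρ ≤ ‖Complex.exp w - 1‖ := by
    have h1 := norm_sub_norm_le (Complex.exp w) 1
    rw [Complex.norm_exp, norm_one, hwre] at h1
    linarith [Real.add_one_le_exp (2 * Real.pi * a * ρ)]
  have hnum : ‖Complex.exp (Complex.I * Real.pi * (j : ℂ) / 2)‖ = 1 := by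
    have : Complex.I * Real.pi * (j : ℂ) / 2 = ((Real.pi * j / 2 : ℝ) : ℂ) * Complex.I := by
      push_cast; ring
    rw [this, Complex.norm_exp_ofReal_mul_I]
  rw [norm_mul, norm_div, norm_div, hnum, norm_one, Complex.norm_natCast]
  calc 1 / ((n : ℕ) : ℝ) * (1 / ‖Complex.exp w - 1‖)
      ≤ 1 / ((n : ℕ) : ℝ) * (1 / (2 * Real.pi * a * ρ)) := by gcongr
    _ = _ := by
      have e1 : a = (2 * Real.pi / x) ^ ((1 : ℝ) / N) * ((n : ℕ) : ℝ) ^ ((1 : ℝ) / N) := by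
        rw [ha, ← Real.mul_rpow (by positivity) hn.le]
        congr 1; ring
      have e2 : ((n : ℕ) : ℝ) ^ (-(1 + 1 / (N : ℝ))) =
          1 / (((n : ℕ) : ℝ) * ((n : ℕ) : ℝ) ^ ((1 : ℝ) / N)) := by
        rw [Real.rpow_neg hn.le, Real.rpow_add hn, Real.rpow_one, inv_eq_one_div]
      rw [e1, e2]
      field_simp

/-- With `a^N = c (m + 1)` the kernel is `c` times the rational summand of
`hasSum_pow_div_pow_add_pow`; the subtracted term is precisely the non-exponential part of that sum.
-/
theorem regularized_tsum_lambertKernel {e : ℕ} (he : 1 ≤ e) {x : ℝ} (hx : 0 < x) (m : ℕ) :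
    ((∑' n : ℕ, lambertKernel (2 * e) (2 * Real.pi / x) (m + 1) (n + 1) -
        Real.pi / (2 * (((2 * e : ℕ) : ℝ) + 1) * (m + 1)) : ℝ) : ℂ) =
      Real.pi * ((-1) ^ e / ((2 * e + 1 : ℕ) : ℂ) *
        ∑ j ∈ stepTwoIndices (2 * e + 1), rotatedLambertTerm (2 * e + 1) x j m.succPNat) := by
  have hpi := Real.pi_pos
  set a : ℝ := (2 * Real.pi * ((m.succPNat : ℕ) : ℝ) / x) ^ ((1 : ℝ) / ((2 * e + 1 : ℕ) : ℝ)) with ha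
  have hm : ((m.succPNat : ℕ) : ℝ) = (m : ℝ) + 1 := by simp
  have hm0 : (0 : ℝ) < (m : ℝ) + 1 := by positivity
  have hbase : 0 < 2 * Real.pi * ((m.succPNat : ℕ) : ℝ) / x := by rw [hm]; positivity
  have ha0 : 0 < a := Real.rpow_pos_of_pos hbase _
  have haN : a ^ (2 * e + 1) = 2 * Real.pi / x * (m + 1) := by
    rw [ha, one_div, Real.rpow_inv_natCast_pow hbase.le (by omega), hm]
    ring
  have h := (hasSum_pow_div_pow_add_pow he ha0).mul_left ((2 * Real.pi / x : ℝ) : ℂ)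
  have hker : ((∑' n : ℕ, lambertKernel (2 * e) (2 * Real.pi / x) (m + 1) (n + 1) : ℝ) : ℂ) =
      ∑' n : ℕ, ((2 * Real.pi / x : ℝ) : ℂ) * (((n : ℂ) + 1) ^ (2 * e) /
        (((n : ℂ) + 1) ^ (2 * (2 * e + 1)) + (a : ℂ) ^ (2 * (2 * e + 1)))) := by
    rw [Complex.ofReal_tsum]
    refine tsum_congr fun n => ?_
    have : lambertKernel (2 * e) (2 * Real.pi / x) (m + 1) (n + 1) =
        2 * Real.pi / x * (((n : ℝ) + 1) ^ (2 * e) /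
        (((n : ℝ) + 1) ^ (2 * (2 * e + 1)) + a ^ (2 * (2 * e + 1)))) := by
      rw [lambertKernel, ← haN, ← pow_mul, mul_comm (2 * e + 1) 2,
        show 2 * (2 * e) + 2 = 2 * (2 * e + 1) by ring]
      ring
    rw [this]
    push_cast
    rfl
  have hmC : ((m : ℂ) + 1) ≠ 0 := by exact_mod_cast hm0.ne'
  have hterm : ∀ j, rotatedLambertTerm (2 * e + 1) x j m.succPNat = 1 / ((m : ℂ) + 1) *
      (Complex.exp (Complex.I * Real.pi * (j : ℂ) / 2) /
            (Complex.exp (2 * Real.pi * a *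
              Complex.exp (-(Complex.I * Real.pi * (j : ℂ)) / (2 * ((2 * e + 1 : ℕ) : ℂ)))) - 1)) := by
    intro j
    rw [rotatedLambertTerm, ← ha]
    congr 2
    simp
  have haC : (a : ℂ) ^ (2 * e + 1) = ((2 * Real.pi / x : ℝ) : ℂ) * (m + 1) := by
    exact_mod_cast congrArg (fun r : ℝ => (r : ℂ)) haN
  rw [Complex.ofReal_sub, hker, h.tsum_eq, haC, Finset.sum_congr rfl fun j _ => hterm j,
    ← Finset.mul_sum]
  have hc0 : ((2 * Real.pi / x : ℝ) : ℂ) ≠ 0 := by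
    exact_mod_cast (show 2 * Real.pi / x ≠ 0 by positivity)
  generalize ((2 * Real.pi / x : ℝ) : ℂ) = c at hc0
  have hN0 : (2 * (e : ℂ) + 1) ≠ 0 := by exact_mod_cast Nat.succ_ne_zero (2 * e)
  push_cast
  field_simp
  ring

theorem corollary2p6 (N : ℕ) (hN : Odd N) (hN1 : 1 < N) (x : ℝ) (hx : 0 < x) :
    Summable (fun n : ℕ+ =>
      1 / (((n : ℕ) : ℝ) * (Real.exp (((n : ℕ) : ℝ) ^ N * x) - 1))) ∧
    (∀ j ∈ stepTwoIndices N, Summable (rotatedLambertTerm N x j)) ∧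
    ((∑' n : ℕ+, 1 / (((n : ℕ) : ℝ) * (Real.exp (((n : ℕ) : ℝ) ^ N * x) - 1)) : ℝ) : ℂ) =
      ((1 / (2 * (N : ℝ)) *
        (Real.eulerMascheroniConstant * (1 - (N : ℝ)) + Real.log (x / (2 * Real.pi))) : ℝ) : ℂ) +
      riemannZeta ((N : ℂ) + 1) / (x : ℂ) +
      (-1 : ℂ) ^ ((N + 3) / 2) / (N : ℂ) *
        ∑ j ∈ stepTwoIndices N, ∑' n : ℕ+, rotatedLambertTerm N x j n := by
  obtain ⟨e, rfl⟩ := hN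
  have he : 1 ≤ e := by omega
  obtain ⟨hu, hL⟩ := tsum_lambert_eq (2 * e) hx
  have hrot : ∀ j ∈ stepTwoIndices (2 * e + 1), Summable (rotatedLambertTerm (2 * e + 1) x j) :=
    fun j hj => summable_rotatedLambertTerm hx hj
  refine ⟨?_, hrot, ?_⟩
  · rw [← Equiv.pnatEquivNat.symm.summable_iff]
    refine hu.congr fun n => ?_
    simp
  have hleft : ∑' n : ℕ+, 1 / (((n : ℕ) : ℝ) * (Real.exp (((n : ℕ) : ℝ) ^ (2 * e + 1) * x) - 1)) =
      ∑' n : ℕ, 1 / (((n : ℝ) + 1) * (Real.exp (((n : ℝ) + 1) ^ (2 * e + 1) * x) - 1)) := by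
    rw [← Equiv.pnatEquivNat.symm.tsum_eq]
    exact tsum_congr fun n => by simp
  have hzeta : riemannZeta (((2 * e + 1 : ℕ) : ℂ) + 1) =
      ((∑' n : ℕ, 1 / ((n : ℝ) + 1) ^ (2 * e + 2) : ℝ) : ℂ) := by
    rw [zeta_eq_tsum_one_div_nat_add_one_cpow (by simp; positivity), Complex.ofReal_tsum]
    refine tsum_congr fun n => ?_
    have : ((2 * e + 1 : ℕ) : ℂ) + 1 = ((2 * e + 2 : ℕ) : ℂ) := by push_cast; ring
    rw [this, Complex.cpow_natCast]
    push_cast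
    rfl
  have hright : ∑ j ∈ stepTwoIndices (2 * e + 1), ∑' n : ℕ+, rotatedLambertTerm (2 * e + 1) x j n =
      ∑' m : ℕ, ∑ j ∈ stepTwoIndices (2 * e + 1),
        rotatedLambertTerm (2 * e + 1) x j m.succPNat := by
    refine Eq.trans (Finset.sum_congr rfl fun j _ => (Equiv.pnatEquivNat.symm.tsum_eq _).symm)
      (Summable.tsum_finsetSum fun j hj =>
        Equiv.pnatEquivNat.symm.summable_iff.2 (hrot j hj)).symm
  have hpow : (-1 : ℂ) ^ ((2 * e + 1 + 3) / 2) = (-1) ^ e := by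
    rw [show (2 * e + 1 + 3) / 2 = e + 2 by omega, pow_add]; simp
  have hpi : (Real.pi : ℂ) ≠ 0 := by exact_mod_cast Real.pi_ne_zero
  rw [hleft, hL, hzeta, hright, hpow, Complex.ofReal_add, Complex.ofReal_add,
    Complex.ofReal_mul (1 / Real.pi), Complex.ofReal_tsum,
    tsum_congr fun m => regularized_tsum_lambertKernel he hx m, tsum_mul_left, tsum_mul_left]
  push_cast
  field_simp
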